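/- Let $K_n$ be the complete graph on $[n]=\{1,\dots,n\}$ with edge set $E$, $|E|=\binom n2$. Let $F_n\subseteq\{0,1\}^{E}$ be the set of feasible solutions of the symmetric traveling salesman problem, that is, the set of all $x\in\{0,1\}^{E}$ with $$\sum_{j\ne i}x_{ij}=2\quad\text{for all } i\in[n],\qquad \sum_{ij\in E,\; i,j\in A}x_{ij}\le |A|-1\quad\text{for all }\emptyset\subsetneq A\subsetneq[n].$$ The diameter polytope of the symmetric traveling salesman problem is $$P^n:=\operatorname{conv}\bigl\{x\oplus y\oplus z\in\{0,1\}^{3\binom n2}\;:\;x,y\in F_n,\ x_{ij}+y_{ij}-z_{ij}\le 1\text{ for all }ij\in E\bigr\}.$$ If $n\ge 5$, then $P^n$ is nonempty and its dimension (the dimension of its affine hull) is $$\dim P^n=\frac{3n^2-7n}{2}.$$ -/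

import Mathlib

/-- The edges `ij`, `i ≠ j`, of the complete graph `K_n` on the vertex set `Fin n`. -/
abbrev KEdge (n : ℕ) : Type := ↥((⊤ : SimpleGraph (Fin n)).edgeSet)

/-- `x(S) = ∑_{ij ∈ S} x_{ij}` for a set `S` of edges of `K_n`. -/
def edgeWeight {n : ℕ} (x : KEdge n → ℝ) (S : Finset (KEdge n)) : ℝ :=
  ∑ e ∈ S, x e

/-- The edges of `K_n` incident with the vertex `i`. -/
def incidentEdges {n : ℕ} (i : Fin n) : Finset (KEdge n) :=
  Finset.univ.filter fun e => i ∈ e.1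

/-- The edges of the induced subgraph `K_n[A]`: both endpoints lie in `A`. -/
def inducedEdges {n : ℕ} (A : Finset (Fin n)) : Finset (KEdge n) :=
  Finset.univ.filter fun e => ∀ v ∈ e.1, v ∈ A

/-- The feasible solutions of the symmetric travelling salesman problem on `K_n`: binary vectors
that satisfy the degree equations and the subtour elimination inequalities. -/
def tspFeasible (n : ℕ) : Set (KEdge n → ℝ) :=
  {x | (∀ i : Fin n, edgeWeight x (incidentEdges i) = 2) ∧
    (∀ A : Finset (Fin n), ∅ ⊂ A → A ⊂ Finset.univ →
      edgeWeight x (inducedEdges A) ≤ (A.card : ℝ) - 1) ∧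
    ∀ e, x e = 0 ∨ x e = 1}

/-- The points `x ⊕ y ⊕ z` feasible for the diameter binary program of the symmetric TSP. -/
def tspDiameterFeasible (n : ℕ) :
    Set ((KEdge n → ℝ) × (KEdge n → ℝ) × (KEdge n → ℝ)) :=
  {p | p.1 ∈ tspFeasible n ∧ p.2.1 ∈ tspFeasible n ∧
    (∀ e, p.2.2 e = 0 ∨ p.2.2 e = 1) ∧
    ∀ e, p.1 e + p.2.1 e - p.2.2 e ≤ 1}

/-- The diameter polytope of the symmetric TSP. -/
def tspDiameterPolytope (n : ℕ) :
    Set ((KEdge n → ℝ) × (KEdge n → ℝ) × (KEdge n → ℝ)) :=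
  convexHull ℝ (tspDiameterFeasible n)

/-- The dimension of a nonempty polytope: the dimension of its affine span. -/
noncomputable def polytopeDim {V : Type*} [AddCommGroup V] [Module ℝ V] (P : Set V) : ℕ :=
  Module.finrank ℝ (affineSpan ℝ P).direction

/-! The direction space of the polytope is exactly the kernel of the degree equations for x and y
(`vectorSpan_tspDiameterFeasible`). These 2n equations are independent, so the dimension is 3·C(n,2)
- 2n. One inclusion is immediate; the other is by duality. Let f be a linear functional vanishing on
all differences of feasible points. With z = 1 the coupling constraint is void, so the x-part and
y-part of f are each constant on tours. Exchanging two vertices of a tour forces their coefficients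
into the form a_i + a_j (`exists_edgeCoeff_eq_add`), making them combinations of degree equations.
The z-part is zero, because every edge is missed by some tour and its z-coordinate can then be
switched. -/

section TourVectors

variable {m : ℕ}

/-- The edge of `K_n` joining two distinct vertices. -/
def KEdge.mk {n : ℕ} (i j : Fin n) (h : i ≠ j) : KEdge n :=
  ⟨s(i, j), by simpa using h⟩

theorem KEdge.mk_comm {n : ℕ} {i j : Fin n} (h : i ≠ j) : KEdge.mk i j h = KEdge.mk j i h.symm :=
  Subtype.ext Sym2.eq_swap

theorem fin_add_one_ne (p : Fin (m + 4)) : p + 1 ≠ p := by simp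

theorem fin_val_one_add_one : (1 + 1 : Fin (m + 4)).val = 2 := by
  rw [Fin.val_add, Fin.val_one, Nat.mod_eq_of_lt (by omega)]

theorem fin_val_one_add_one_add_one : (1 + 1 + 1 : Fin (m + 4)).val = 3 := by
  rw [Fin.val_add, fin_val_one_add_one, Fin.val_one, Nat.mod_eq_of_lt (by omega)]

theorem fin_add_one_add_one_ne (p : Fin (m + 4)) : p + 1 + 1 ≠ p := by
  rw [add_assoc, Ne, add_eq_left, Fin.ext_iff, fin_val_one_add_one]
  simp

theorem fin_add_one_add_one_add_one_ne (p : Fin (m + 4)) : p + 1 + 1 + 1 ≠ p := by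
  rw [add_assoc, add_assoc, ← add_assoc 1, Ne, add_eq_left, Fin.ext_iff,
    fin_val_one_add_one_add_one]
  simp

/-- The edge that the closed tour `σ 0, σ 1, …` uses to leave its `p`-th vertex. -/
def tourEdge (σ : Equiv.Perm (Fin (m + 4))) (p : Fin (m + 4)) : KEdge (m + 4) :=
  KEdge.mk (σ p) (σ (p + 1)) fun h => fin_add_one_ne p (σ.injective h).symm

theorem tourEdge_injective (σ : Equiv.Perm (Fin (m + 4))) : Function.Injective (tourEdge σ) := by
  intro p q h
  have h' : s(σ p, σ (p + 1)) = s(σ q, σ (q + 1)) := congrArg Subtype.val h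
  rw [Sym2.eq_iff] at h'
  rcases h' with ⟨h1, -⟩ | ⟨h1, h2⟩
  · exact σ.injective h1
  · have h1 := σ.injective h1
    have h2 := σ.injective h2
    exact absurd (by rw [← h1, h2]) (fin_add_one_add_one_ne q)

/-- The incidence vector of the Hamiltonian cycle visiting the vertices in the order `σ`. -/
noncomputable def tourVector (σ : Equiv.Perm (Fin (m + 4))) : KEdge (m + 4) → ℝ :=
  ∑ p, Pi.single (tourEdge σ p) 1

theorem tourVector_apply (σ : Equiv.Perm (Fin (m + 4))) (e : KEdge (m + 4)) :
    tourVector σ e = (Finset.univ.filter fun p => tourEdge σ p = e).card := by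
  simp [tourVector, Finset.sum_apply, Pi.single_apply, eq_comm]

theorem edgeWeight_tourVector (σ : Equiv.Perm (Fin (m + 4))) (S : Finset (KEdge (m + 4))) :
    edgeWeight (tourVector σ) S = (Finset.univ.filter fun p => tourEdge σ p ∈ S).card := by
  simp only [edgeWeight, tourVector, Finset.sum_apply]
  rw [Finset.sum_comm]
  simp [Pi.single_apply]

theorem mem_incidentEdges_tourEdge (σ : Equiv.Perm (Fin (m + 4))) (p i : Fin (m + 4)) :
    tourEdge σ p ∈ incidentEdges i ↔ p = σ.symm i ∨ p = σ.symm i - 1 := by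
  simp only [incidentEdges, tourEdge, KEdge.mk, Finset.mem_filter, Finset.mem_univ, true_and,
    Sym2.mem_iff, Equiv.eq_symm_apply, eq_sub_iff_add_eq]
  constructor <;> rintro (h | h) <;> simp [h]

theorem mem_inducedEdges_tourEdge (σ : Equiv.Perm (Fin (m + 4))) (p : Fin (m + 4))
    (A : Finset (Fin (m + 4))) :
    tourEdge σ p ∈ inducedEdges A ↔ σ p ∈ A ∧ σ (p + 1) ∈ A := by
  simp [inducedEdges, tourEdge, KEdge.mk]

open scoped Fin.NatCast in
-- Otherwise A is closed under the tour's successor map, which reaches every vertex. This yields the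
-- subtour inequalities.
theorem exists_tour_leaves (σ : Equiv.Perm (Fin (m + 4))) {A : Finset (Fin (m + 4))}
    (h0 : A.Nonempty) (h1 : A ≠ Finset.univ) : ∃ p, σ p ∈ A ∧ σ (p + 1) ∉ A := by
  by_contra! h
  obtain ⟨a, ha⟩ := h0
  have key : ∀ k : ℕ, σ (σ.symm a + (k : Fin (m + 4))) ∈ A := by
    intro k
    induction k with
    | zero => simpa using ha
    | succ k ih => simpa [add_assoc] using h _ ih
  refine h1 (Finset.eq_univ_iff_forall.2 fun b => ?_)
  simpa using key (σ.symm b - σ.symm a).val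

theorem tourVector_mem_tspFeasible (σ : Equiv.Perm (Fin (m + 4))) :
    tourVector σ ∈ tspFeasible (m + 4) := by
  refine ⟨fun i => ?_, fun A hA hA' => ?_, fun e => ?_⟩
  · have : (Finset.univ.filter fun p => tourEdge σ p ∈ incidentEdges i)
        = {σ.symm i, σ.symm i - 1} := by
      ext p
      simp [mem_incidentEdges_tourEdge]
    rw [edgeWeight_tourVector, this, Finset.card_pair]
    · norm_num
    · simp [eq_sub_iff_add_eq]
  · obtain ⟨q, hq, hq'⟩ := exists_tour_leaves σ (Finset.empty_ssubset.1 hA) hA'.ne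
    have hsub : (Finset.univ.filter fun p => tourEdge σ p ∈ inducedEdges A) ⊆
        (A.map σ.symm.toEmbedding).erase q := by
      intro p hp
      simp only [Finset.mem_filter, Finset.mem_univ, true_and, mem_inducedEdges_tourEdge] at hp
      simp only [Finset.mem_erase, Finset.mem_map_equiv, Equiv.symm_symm]
      exact ⟨fun h => hq' (h ▸ hp.2), hp.1⟩
    have hcard := Finset.card_le_card hsub
    rw [Finset.card_erase_of_mem (by simpa using hq), Finset.card_map] at hcard
    have hpos : 0 < A.card := Finset.card_pos.2 (Finset.empty_ssubset.1 hA)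
    rw [edgeWeight_tourVector, le_sub_iff_add_le]
    exact_mod_cast (by omega : _ + 1 ≤ A.card)
  · have : (Finset.univ.filter fun p => tourEdge σ p = e).card ≤ 1 :=
      Finset.card_le_one.2 fun p hp q hq => tourEdge_injective σ <| by
        rw [(Finset.mem_filter.1 hp).2, (Finset.mem_filter.1 hq).2]
    rw [tourVector_apply]
    rcases Nat.le_one_iff_eq_zero_or_eq_one.1 this with h | h <;> simp [h]

/-- Four distinct vertices can be put in the first four positions of a tour. -/
theorem exists_perm_four {i j k l : Fin (m + 4)} (hij : i ≠ j) (hik : i ≠ k) (hil : i ≠ l)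
    (hjk : j ≠ k) (hjl : j ≠ l) (hkl : k ≠ l) :
    ∃ σ : Equiv.Perm (Fin (m + 4)),
      σ 0 = i ∧ σ 1 = j ∧ σ (1 + 1) = k ∧ σ (1 + 1 + 1) = l := by
  obtain ⟨σ, hσ⟩ := Equiv.Perm.exists_extending_pair
    (Fin.castLE (Nat.le_add_left 4 m)) ![i, j, k, l] (Fin.castLE_injective _) (by
      intro a b
      fin_cases a <;> fin_cases b <;> simp_all [eq_comm])
  refine ⟨σ, hσ 0, hσ 1, ?_, ?_⟩
  · rw [show (1 + 1 : Fin (m + 4)) = Fin.castLE (Nat.le_add_left 4 m) 2 from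
      Fin.ext fin_val_one_add_one]
    exact hσ 2
  · rw [show (1 + 1 + 1 : Fin (m + 4)) = Fin.castLE (Nat.le_add_left 4 m) 3 from
      Fin.ext fin_val_one_add_one_add_one]
    exact hσ 3

theorem exists_ne_three (i j k : Fin (m + 4)) : ∃ l, l ≠ i ∧ l ≠ j ∧ l ≠ k := by
  obtain ⟨l, hl⟩ := Finset.exists_mem_notMem_of_card_lt_card
    (s := {i, j, k}) (t := (Finset.univ : Finset (Fin (m + 4))))
    (lt_of_le_of_lt Finset.card_le_three (by simp))
  exact ⟨l, by simpa using hl⟩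

/-- Every edge is avoided by some tour. -/
theorem exists_tourVector_apply_eq_zero (e : KEdge (m + 4)) :
    ∃ σ : Equiv.Perm (Fin (m + 4)), tourVector σ e = 0 := by
  obtain ⟨e, he⟩ := e
  induction e using Sym2.ind with
  | _ a b =>
  have hab : a ≠ b := by simpa using he
  obtain ⟨c, hca, hcb, -⟩ := exists_ne_three a b b
  obtain ⟨d, hda, hdb, hdc⟩ := exists_ne_three a b c
  -- The endpoints go to positions 0 and 2, so the edge becomes a chord of the tour.
  obtain ⟨σ, rfl, rfl, rfl, rfl⟩ := exists_perm_four hca.symm hab hda.symm hcb hdc.symm hdb.symm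
  refine ⟨σ, ?_⟩
  rw [tourVector_apply, Nat.cast_eq_zero, Finset.card_eq_zero, Finset.filter_eq_empty_iff]
  intro p _ h
  have h' : s(σ p, σ (p + 1)) = s(σ 0, σ (1 + 1)) := congrArg Subtype.val h
  rw [Sym2.eq_iff] at h'
  rcases h' with ⟨h1, h2⟩ | ⟨h1, h2⟩ <;> have h1 := σ.injective h1 <;> have h2 := σ.injective h2 <;>
    subst h1
  · simp at h2
  · exact fin_add_one_add_one_add_one_ne 0 (by simpa using h2)

end TourVectors

section LinearFunctionals

variable {m : ℕ}

/-- The coefficient of the edge `ij` in a linear functional. -/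
noncomputable def edgeCoeff {n : ℕ} (f : (KEdge n → ℝ) →ₗ[ℝ] ℝ) (i j : Fin n) : ℝ :=
  if h : i ≠ j then f (Pi.single (KEdge.mk i j h) 1) else 0

theorem edgeCoeff_comm {n : ℕ} (f : (KEdge n → ℝ) →ₗ[ℝ] ℝ) (i j : Fin n) :
    edgeCoeff f i j = edgeCoeff f j i := by
  unfold edgeCoeff
  by_cases h : i = j
  · simp [h]
  · rw [dif_pos h, dif_pos (Ne.symm h), KEdge.mk_comm]

theorem map_tourVector (f : (KEdge (m + 4) → ℝ) →ₗ[ℝ] ℝ) (σ : Equiv.Perm (Fin (m + 4))) :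
    f (tourVector σ) = ∑ p, edgeCoeff f (σ p) (σ (p + 1)) := by
  rw [tourVector, map_sum]
  refine Finset.sum_congr rfl fun p _ => ?_
  rw [edgeCoeff, dif_pos]
  rfl

/-- Exchanging the second and third vertex of a tour shows that two perfect matchings of four
vertices have the same weight under a functional that is constant on tours. -/
theorem edgeCoeff_exchange {f : (KEdge (m + 4) → ℝ) →ₗ[ℝ] ℝ}
    (hf : ∀ σ τ, f (tourVector σ) = f (tourVector τ))
    {i j k l : Fin (m + 4)} (hij : i ≠ j) (hik : i ≠ k) (hil : i ≠ l)
    (hjk : j ≠ k) (hjl : j ≠ l) (hkl : k ≠ l) :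
    edgeCoeff f i j + edgeCoeff f k l = edgeCoeff f i k + edgeCoeff f j l := by
  obtain ⟨σ, rfl, rfl, rfl, rfl⟩ := exists_perm_four hij hik hil hjk hjl hkl
  have h := hf σ (Equiv.swap 1 (1 + 1) |>.trans σ)
  rw [map_tourVector, map_tourVector, ← sub_eq_zero, ← Finset.sum_sub_distrib] at h
  -- Only the edges leaving positions 0, 1, 2 can change; the middle one is merely reversed and
  -- cancels.
  rw [← Finset.sum_subset (Finset.subset_univ {0, 1, 1 + 1})] at h
  · have h3 : (1 + 1 + 1 : Fin (m + 4)) ≠ 1 := fin_add_one_add_one_ne 1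
    have h2 : (0 : Fin (m + 4)) ≠ 1 + 1 := by
      simpa using (fin_add_one_add_one_ne (0 : Fin (m + 4))).symm
    rw [Finset.sum_insert (by simp [h2]), Finset.sum_pair (by simp)] at h
    simp only [Equiv.trans_apply, Equiv.swap_apply_left, Equiv.swap_apply_right, zero_add] at h
    rw [Equiv.swap_apply_of_ne_of_ne (by simp) h2,
      Equiv.swap_apply_of_ne_of_ne h3 (by simp), edgeCoeff_comm f (σ (1 + 1)) (σ 1)] at h
    linarith
  · intro p _ hp
    simp only [Finset.mem_insert, Finset.mem_singleton, not_or] at hp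
    rw [sub_eq_zero, Equiv.trans_apply, Equiv.trans_apply,
      Equiv.swap_apply_of_ne_of_ne hp.2.1 hp.2.2, Equiv.swap_apply_of_ne_of_ne]
    · intro h; exact hp.1 (by simpa using h)
    · intro h; exact hp.2.1 (by simpa using h)

/-- If c_ij = a_i + a_j, then 2a_i = c_ij + c_ik - c_jk. The exchange identity makes the right side
independent of j and k, so it can define a_i. -/
theorem exists_edgeCoeff_eq_add {f : (KEdge (m + 4) → ℝ) →ₗ[ℝ] ℝ}
    (hf : ∀ σ τ, f (tourVector σ) = f (tourVector τ)) :
    ∃ a : Fin (m + 4) → ℝ, ∀ i j, i ≠ j → edgeCoeff f i j = a i + a j := by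
  have key : ∀ i j k k', i ≠ j → i ≠ k → i ≠ k' → j ≠ k → j ≠ k' →
      edgeCoeff f i j + edgeCoeff f i k - edgeCoeff f j k =
        edgeCoeff f i j + edgeCoeff f i k' - edgeCoeff f j k' := by
    intro i j k k' hij hik hik' hjk hjk'
    rcases eq_or_ne k k' with rfl | hkk
    · rfl
    have := edgeCoeff_exchange hf hik hij hik' hjk.symm hkk hjk'
    have := edgeCoeff_exchange hf hik hik' hij hkk hjk.symm hjk'.symm
    rw [edgeCoeff_comm f k j, edgeCoeff_comm f k' j] at *
    linarith
  have hex : ∀ i : Fin (m + 4), ∃ j k, i ≠ j ∧ i ≠ k ∧ j ≠ k := by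
    intro i
    obtain ⟨j, hj, -⟩ := exists_ne_three i i i
    obtain ⟨k, hk, hk', -⟩ := exists_ne_three i j j
    exact ⟨j, k, hj.symm, hk.symm, hk'.symm⟩
  choose u v huv using hex
  let a : Fin (m + 4) → ℝ := fun i =>
    (edgeCoeff f i (u i) + edgeCoeff f i (v i) - edgeCoeff f (u i) (v i)) / 2
  have ha : ∀ i j k, i ≠ j → i ≠ k → j ≠ k →
      2 * a i = edgeCoeff f i j + edgeCoeff f i k - edgeCoeff f j k := by
    intro i j k hij hik hjk
    obtain ⟨h1, h2, h3⟩ := huv i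
    -- The vertex w allows replacing one vertex at a time: (u,v), (u,w), (j,w), (j,k).
    obtain ⟨w, hwi, hwu, hwj⟩ := exists_ne_three i (u i) j
    have e1 := key i (u i) (v i) w h1 h2 hwi.symm h3 hwu.symm
    have e2 := key i j k w hij hik hwi.symm hjk hwj.symm
    rcases eq_or_ne (u i) j with h | h
    · subst h
      simp only [a]; linarith
    · have e3 := key i w (u i) j hwi.symm h1 hij hwu hwj
      rw [edgeCoeff_comm f w (u i), edgeCoeff_comm f w j] at e3
      simp only [a]; linarith
  refine ⟨a, fun i j hij => ?_⟩
  obtain ⟨k, hki, hkj, -⟩ := exists_ne_three i j j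
  have h1 := ha i j k hij hki.symm hkj.symm
  have h2 := ha j i k hij.symm hkj.symm hki.symm
  rw [edgeCoeff_comm f j i] at h2
  linarith

theorem map_eq_sum_edgeWeight {n : ℕ} {f : (KEdge n → ℝ) →ₗ[ℝ] ℝ} {a : Fin n → ℝ}
    (ha : ∀ i j, i ≠ j → edgeCoeff f i j = a i + a j) (v : KEdge n → ℝ) :
    f v = ∑ i, a i * edgeWeight v (incidentEdges i) := by
  have hc : ∀ e : KEdge n, f (Pi.single e 1) = ∑ i, if i ∈ e.1 then a i else 0 := by
    rintro ⟨e, he⟩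
    induction e using Sym2.ind with
    | _ i j =>
    have hij : i ≠ j := by simpa using he
    have := ha i j hij
    rw [edgeCoeff, dif_pos hij] at this
    rw [show (⟨s(i, j), he⟩ : KEdge n) = KEdge.mk i j hij from rfl, this, ← Finset.sum_filter,
      show (Finset.univ.filter fun x => x ∈ (KEdge.mk i j hij).1) = {i, j} by
        ext; simp [KEdge.mk], Finset.sum_pair hij]
  have hv : v = ∑ e, v e • Pi.single e (1 : ℝ) := by
    ext e
    simp [Finset.sum_apply, Pi.single_apply]
  conv_lhs => rw [hv]
  simp only [map_sum, map_smul, hc, smul_eq_mul, edgeWeight, incidentEdges, Finset.mul_sum,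
    Finset.sum_filter]
  rw [Finset.sum_comm]
  refine Finset.sum_congr rfl fun i _ => Finset.sum_congr rfl fun e _ => ?_
  split_ifs <;> ring

/-- A functional that is constant on tours vanishes on the kernel of the degree equations. -/
theorem map_eq_zero_of_const_on_tours {f : (KEdge (m + 4) → ℝ) →ₗ[ℝ] ℝ}
    (hf : ∀ σ τ, f (tourVector σ) = f (tourVector τ)) {v : KEdge (m + 4) → ℝ}
    (hv : ∀ i, edgeWeight v (incidentEdges i) = 0) : f v = 0 := by
  obtain ⟨a, ha⟩ := exists_edgeCoeff_eq_add hf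
  simp [map_eq_sum_edgeWeight ha, hv]

end LinearFunctionals

section Dimension

variable {m : ℕ}

/-- The left-hand sides of the degree equations. -/
def degreeMap (n : ℕ) : (KEdge n → ℝ) →ₗ[ℝ] (Fin n → ℝ) where
  toFun x i := edgeWeight x (incidentEdges i)
  map_add' x y := by ext i; simp [edgeWeight, Finset.sum_add_distrib]
  map_smul' c x := by ext i; simp [edgeWeight, Finset.mul_sum]

theorem degreeMap_single {n : ℕ} (i j : Fin n) (h : i ≠ j) :
    degreeMap n (Pi.single (KEdge.mk i j h) 1) = Pi.single i 1 + Pi.single j 1 := by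
  ext k
  simp only [degreeMap, LinearMap.coe_mk, AddHom.coe_mk, edgeWeight, Pi.single_apply,
    Finset.sum_ite_eq', incidentEdges, KEdge.mk, Finset.mem_filter, Finset.mem_univ, true_and,
    Sym2.mem_iff, Pi.add_apply]
  by_cases h1 : k = i
  · subst h1; simp [h]
  · simp [h1]

theorem degreeMap_surjective : Function.Surjective (degreeMap (m + 4)) := by
  rw [← LinearMap.range_eq_top, eq_top_iff, ← Pi.basisFun ℝ (Fin (m + 4)) |>.span_eq,
    Submodule.span_le]
  rintro _ ⟨i, rfl⟩
  obtain ⟨j, hj, -⟩ := exists_ne_three i i i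
  obtain ⟨k, hk, hk', -⟩ := exists_ne_three i j j
  -- In the triangle ijk, the edges ij and ik minus jk have degree 2 at i and 0 elsewhere.
  refine ⟨(1 / 2 : ℝ) • (Pi.single (KEdge.mk i j hj.symm) 1 + Pi.single (KEdge.mk i k hk.symm) 1
    - Pi.single (KEdge.mk j k hk'.symm) 1), ?_⟩
  simp only [map_smul, map_sub, map_add, degreeMap_single, Pi.basisFun_apply]
  module

/-- The degree equations of both tours. -/
def degreePairMap (n : ℕ) :
    ((KEdge n → ℝ) × (KEdge n → ℝ) × (KEdge n → ℝ)) →ₗ[ℝ] (Fin n → ℝ) × (Fin n → ℝ) :=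
  (degreeMap n ∘ₗ LinearMap.fst ℝ _ _).prod
    (degreeMap n ∘ₗ LinearMap.fst ℝ _ _ ∘ₗ LinearMap.snd ℝ _ _)

theorem degreePairMap_surjective : Function.Surjective (degreePairMap (m + 4)) := by
  rintro ⟨a, b⟩
  obtain ⟨x, rfl⟩ := degreeMap_surjective a
  obtain ⟨y, rfl⟩ := degreeMap_surjective b
  exact ⟨(x, y, 0), rfl⟩

theorem finrank_ker_degreePairMap :
    Module.finrank ℝ (LinearMap.ker (degreePairMap (m + 4))) + 2 * (m + 4) =
      3 * (m + 4).choose 2 := by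
  have h := LinearMap.finrank_range_add_finrank_ker (degreePairMap (m + 4))
  have hE : Fintype.card (KEdge (m + 4)) = (m + 4).choose 2 := by
    have := SimpleGraph.card_edgeFinset_top_eq_card_choose_two (V := Fin (m + 4))
    rw [Fintype.card_fin] at this
    rw [← this, SimpleGraph.edgeFinset_card]
  rw [LinearMap.range_eq_top.2 degreePairMap_surjective, finrank_top] at h
  simp only [Module.finrank_prod, Module.finrank_fintype_fun_eq_card, Fintype.card_fin, hE] at h
  omega

theorem tour_pair_mem (σ τ : Equiv.Perm (Fin (m + 4))) :
    (tourVector σ, tourVector τ, fun _ => 1) ∈ tspDiameterFeasible (m + 4) := by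
  have h1 := tourVector_mem_tspFeasible σ
  have h2 := tourVector_mem_tspFeasible τ
  refine ⟨h1, h2, by simp, fun e => ?_⟩
  rcases h1.2.2 e with h | h <;> rcases h2.2.2 e with h' | h' <;> simp [h, h']

/-- When x misses e, the coupling constraint at e holds even with z_e = 0. -/
theorem tour_pair_sub_single_mem (σ τ : Equiv.Perm (Fin (m + 4))) {e : KEdge (m + 4)}
    (he : tourVector σ e = 0) :
    (tourVector σ, tourVector τ, (fun _ => 1) - Pi.single e 1) ∈ tspDiameterFeasible (m + 4) := by
  have h1 := tourVector_mem_tspFeasible σ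
  have h2 := tourVector_mem_tspFeasible τ
  refine ⟨h1, h2, fun d => ?_, fun d => ?_⟩
  · by_cases hd : d = e <;> simp [hd]
  · by_cases hd : d = e
    · subst hd
      rcases h2.2.2 d with h' | h' <;> simp [he, h']
    · rcases h1.2.2 d with h | h <;> rcases h2.2.2 d with h' | h' <;> simp [h, h', hd]

theorem vectorSpan_tspDiameterFeasible :
    vectorSpan ℝ (tspDiameterFeasible (m + 4)) = LinearMap.ker (degreePairMap (m + 4)) := by
  apply le_antisymm
  · rw [vectorSpan, Submodule.span_le]
    rintro _ ⟨p, hp, q, hq, rfl⟩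
    have h1 : degreeMap (m + 4) p.1 = degreeMap (m + 4) q.1 :=
      funext fun i => (hp.1.1 i).trans (hq.1.1 i).symm
    have h2 : degreeMap (m + 4) p.2.1 = degreeMap (m + 4) q.2.1 :=
      funext fun i => (hp.2.1.1 i).trans (hq.2.1.1 i).symm
    simp [degreePairMap, h1, h2]
  · rintro ⟨x, y, z⟩ hv
    by_contra hv'
    -- Separate the vector from the span by a functional f; it suffices that f kills each of its
    -- three blocks.
    obtain ⟨f, hf, hle⟩ := Submodule.exists_le_ker_of_notMem hv'
    have hconst : ∀ p ∈ tspDiameterFeasible (m + 4), ∀ q ∈ tspDiameterFeasible (m + 4),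
        f p = f q := fun p hp q hq => by
      have : f (p - q) = 0 := hle (vsub_mem_vectorSpan ℝ hp hq)
      rwa [map_sub, sub_eq_zero] at this
    replace hv : degreeMap (m + 4) x = 0 ∧ degreeMap (m + 4) y = 0 := Prod.mk.inj hv
    have hsub : ∀ u v w u' v' w' : KEdge (m + 4) → ℝ,
        f (u, v, w) - f (u', v', w') = f (u - u', v - v', w - w') := fun _ _ _ _ _ _ => by
      rw [← map_sub]; rfl
    have hx : f (x, 0, 0) = 0 := by
      refine map_eq_zero_of_const_on_tours (f := f ∘ₗ LinearMap.inl ℝ _ _) (fun σ τ => ?_)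
        (congrFun hv.1)
      have := hsub (tourVector σ) (tourVector 1) (fun _ => 1) (tourVector τ) (tourVector 1)
        (fun _ => 1)
      rw [hconst _ (tour_pair_mem σ 1) _ (tour_pair_mem τ 1), sub_self, sub_self, sub_self] at this
      rw [← sub_eq_zero, ← map_sub]
      exact this.symm
    have hy : f (0, y, 0) = 0 := by
      refine map_eq_zero_of_const_on_tours
        (f := f ∘ₗ LinearMap.inr ℝ _ _ ∘ₗ LinearMap.inl ℝ _ _) (fun σ τ => ?_) (congrFun hv.2)
      have := hsub (tourVector 1) (tourVector σ) (fun _ => 1) (tourVector 1) (tourVector τ)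
        (fun _ => 1)
      rw [hconst _ (tour_pair_mem 1 σ) _ (tour_pair_mem 1 τ), sub_self, sub_self, sub_self] at this
      rw [← sub_eq_zero, ← map_sub]
      exact this.symm
    have hz : f (0, 0, z) = 0 := by
      suffices h : f ∘ₗ LinearMap.inr ℝ _ _ ∘ₗ LinearMap.inr ℝ _ _ = 0 from LinearMap.congr_fun h z
      refine (Pi.basisFun ℝ (KEdge (m + 4))).ext fun e => ?_
      obtain ⟨σ, hσ⟩ := exists_tourVector_apply_eq_zero e
      have := hsub (tourVector σ) (tourVector 1) (fun _ => 1) (tourVector σ) (tourVector 1)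
        ((fun _ => 1) - Pi.single e 1)
      rw [hconst _ (tour_pair_mem σ 1) _ (tour_pair_sub_single_mem σ 1 hσ), sub_self, sub_self,
        sub_self, sub_sub_cancel] at this
      simpa using this.symm
    apply hf
    have : ((x, y, z) : (KEdge (m + 4) → ℝ) × (KEdge (m + 4) → ℝ) × (KEdge (m + 4) → ℝ)) =
        (x, 0, 0) + (0, y, 0) + (0, 0, z) := by simp
    rw [this, map_add, map_add, hx, hy, hz, add_zero, add_zero]

end Dimension

theorem mainTheorem11 (n : ℕ) (hn : 5 ≤ n) :
    (tspDiameterPolytope n).Nonempty ∧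
      (polytopeDim (tspDiameterPolytope n) : ℝ) = (3 * (n : ℝ) ^ 2 - 7 * (n : ℝ)) / 2 := by
  obtain ⟨m, rfl⟩ : ∃ m, n = m + 4 := ⟨n - 4, by omega⟩
  refine ⟨⟨_, subset_convexHull ℝ _ (tour_pair_mem 1 1)⟩, ?_⟩
  rw [polytopeDim, tspDiameterPolytope, affineSpan_convexHull, direction_affineSpan,
    vectorSpan_tspDiameterFeasible]
  have h := congrArg (Nat.cast : ℕ → ℝ) (finrank_ker_degreePairMap (m := m))
  rw [Nat.cast_add, Nat.cast_mul, Nat.cast_mul, Nat.cast_choose_two] at h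
  push_cast at h ⊢
  linarith
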